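/- Let $\mu\neq\delta_1$ be a probability measure on $\mathbb N=\{0,1,2,\dots\}$ with mean $1$ and finite variance. Let $(\mathcal T_k)_{k\ge 0}$ be independent $\mu$-Galton–Watson plane trees, let $(w_k)_{k\ge 0}$ be an infinite ray (the spine), in which $w_{k}$ is the parent of $w_{k+1}$, and attach to every $w_k$ the tree $\mathcal T_k$, so that $w_k$ is the root of $\mathcal T_k$. Let $\mathcal T$ be the resulting infinite tree, rooted at $\varnothing:=w_0$, and let $\mathtt d$ be its graph distance. Almost surely all $\mathcal T_k$ are finite, so that the vertices of $\mathcal T$ can be enumerated as a sequence $(u_i)_{i\ge 0}$ by listing first the vertices of $\mathcal T_0$ in depth-first (lexicographical) order, starting at $u_0=\varnothing$, then those of $\mathcal T_1$ in depth-first order, starting at $w_1$, and so on. Then almost surely \[ \max_{0\le i\le n}\mathtt d(\varnothing,u_i)=n^{\frac12+o(1)}\qquad (n\to\infty), \] that is, almost surely there is a (random) real sequence $(\varepsilon_n)$ with $\varepsilon_n\to 0$ and $\max_{0\le i\le n}\mathtt d(\varnothing,u_i)=n^{\frac12+\varepsilon_n}$ for all $n$. -/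

import Mathlib

open MeasureTheory ProbabilityTheory Filter Topology

/-- The plane tree in which the vertex `p` (a finite word of natural numbers) has `c p` children,
namely `p ++ [0], …, p ++ [c p - 1]`; the root is the empty word. -/
def planeTree (c : List ℕ → ℕ) : Set (List ℕ) :=
  {w | ∀ (p : List ℕ) (j : ℕ), p ++ [j] <+: w → j < c p}

/-- The vertices of the forest obtained by attaching the plane tree with child counts `c k` to the
`k`-th spine vertex `w_k`, for every `k`. The pair `(k, w)` is the vertex `w` of the `k`-th tree, so
that `(k, [])` is `w_k`. The lexicographic order of `ℕ ×ₗ List ℕ` (with the lexicographic order on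
words) visits the trees one after another, each of them in depth-first order. -/
def forest (c : ℕ → List ℕ → ℕ) : Set (ℕ ×ₗ List ℕ) :=
  {v | (ofLex v).2 ∈ planeTree (c (ofLex v).1)}

/-- `u` is the parent of `v`: either `v` is a child of `u` in one of the trees, or `u = w_k` and
`v = w_{k+1}` are consecutive spine vertices. -/
def IsParent (u v : ℕ ×ₗ List ℕ) : Prop :=
  (∃ (k : ℕ) (w : List ℕ) (j : ℕ), u = toLex (k, w) ∧ v = toLex (k, w ++ [j])) ∨
    ∃ k : ℕ, u = toLex (k, []) ∧ v = toLex (k + 1, [])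

/-- The forest as a graph (an infinite tree, thanks to the spine). -/
def forestGraph (c : ℕ → List ℕ → ℕ) : SimpleGraph (forest c) :=
  SimpleGraph.fromRel fun u v => IsParent (u : ℕ ×ₗ List ℕ) (v : ℕ ×ₗ List ℕ)

/-- The root `∅ = w_0` of the forest. -/
def forestRoot (c : ℕ → List ℕ → ℕ) : forest c :=
  ⟨toLex (0, []), fun p j h => by simp at h⟩

/-! The distance from the root to a vertex is its spine index plus its height inside its tree. Three
estimates, each off by a factor `θ > 1` per step at the times n = 4^j, control the maximum of this
height.

Lower bound: generations have mean size 1, so the first h trees cut at h generations hold h²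
vertices on average. For h of order (2/θ)^j Markov's inequality makes this at most n, so u_0, …, u_n
cannot all lie in the box and one of them has height at least h (`exists_le_forestHeight`).

Upper bound: the Laplace transform of a tree's size is at most 1 - a√ε, so the first m trees hold at
most n vertices with probability O(√n/m). For m of order (2θ)^j all of u_0, …, u_n thus lie in the
first m trees (`fst_lt_of_lt_sum`). By Kolmogorov's estimate a tree reaches height h with
probability O(1/h), so none of these m trees reaches a height of order (2θ²)^j.

All failure probabilities decay geometrically in j, so Borel–Cantelli gives `GrowthAt` eventually.
Monotonicity fills in the other times, and θ runs through 1 + 1/(i+1). Both kinds of count are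
instances of `branchSum`: `branchSum 1 0 h` counts the vertices below generation h and `branchSum 0
1 h` those of generation h. -/

/-! ### Generation counts and the branching property. -/

/-- The total weight of the first `h` generations of the plane tree with child counts `c`, when each
of their vertices has weight `a`, plus `b` times the number of vertices of generation `h`. -/
def branchSum (a b : ℕ) : ℕ → (List ℕ → ℕ) → ℕ
  | 0, _ => b
  | h + 1, c => a + ∑ j ∈ Finset.range (c []), branchSum a b h fun w => c (j :: w)

/-- The law of the child counts of a Galton–Watson tree with offspring distribution `μ`. -/
noncomputable def galtonWatson (μ : Measure ℕ) : Measure (List ℕ → ℕ) :=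
  Measure.infinitePi fun _ : List ℕ => μ

instance (μ : Measure ℕ) [IsProbabilityMeasure μ] : IsProbabilityMeasure (galtonWatson μ) := by
  unfold galtonWatson; infer_instance

/-- The child counts of the tree whose root has `x.1` children, the `j`-th of which is the root of
a copy of the tree with child counts `x.2 j`. -/
def graft (x : ℕ × (ℕ → List ℕ → ℕ)) : List ℕ → ℕ
  | [] => x.1
  | j :: w => x.2 j w

lemma measurable_graft : Measurable graft := by
  refine measurable_pi_iff.2 fun w => ?_
  cases w with
  | nil => exact measurable_fst
  | cons j w => simp only [graft]; fun_prop

lemma branchSum_graft (a b h n : ℕ) (d : ℕ → List ℕ → ℕ) :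
    branchSum a b (h + 1) (graft (n, d)) = a + ∑ j ∈ Finset.range n, branchSum a b h (d j) := rfl

@[fun_prop]
lemma measurable_branchSum (a b h : ℕ) : Measurable (branchSum a b h) := by
  induction h with
  | zero => exact measurable_const
  | succ h ih =>
    -- The number of summands is random. Making it a separate countable variable reduces the claim
    -- to sums of fixed length.
    have h1 : Measurable fun p : ℕ × (List ℕ → ℕ) =>
        a + ∑ j ∈ Finset.range p.1, branchSum a b h fun w => p.2 (j :: w) := by
      refine measurable_from_prod_countable_right fun n => ?_
      refine measurable_const.add
        (Finset.measurable_fun_sum (Finset.range n) fun j _ => ih.comp ?_)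
      fun_prop
    have h2 : Measurable fun c : List ℕ → ℕ => (c [], c) := by fun_prop
    exact h1.comp h2

/-- A product over words splits into the factor of the empty word and the factors of the others. -/
lemma prod_words_eq {M : Type*} [CommMonoid M] (s : Finset (List ℕ)) (g : List ℕ → M)
    (hf : Set.InjOn (fun p : ℕ × List ℕ => p.1 :: p.2)
      ((fun p : ℕ × List ℕ => p.1 :: p.2) ⁻¹' (s : Set (List ℕ)))) :
    ∏ w ∈ s, g w = (if [] ∈ s then g [] else 1) *
      ∏ p ∈ s.preimage (fun p : ℕ × List ℕ => p.1 :: p.2) hf, g (p.1 :: p.2) := by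
  classical
  rw [Finset.prod_preimage' (fun p : ℕ × List ℕ => p.1 :: p.2) s hf g,
    ← Finset.prod_filter_mul_prod_filter_not s (fun w => w = [])]
  congr 1
  · split_ifs with h
    · rw [show s.filter (fun w => w = []) = {[]} by ext w; aesop, Finset.prod_singleton]
    · refine Finset.prod_eq_one fun w hw => ?_
      aesop
  · refine Finset.prod_congr (Finset.filter_congr fun w _ => ?_) fun _ _ => rfl
    cases w <;> simp

/-- A word is empty or of the form `j :: w`, so the product probability of a cylinder factors into
the root's part and the subtrees' parts. This is the branching property. -/
lemma map_graft (μ : Measure ℕ) [IsProbabilityMeasure μ] :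
    (μ.prod (Measure.infinitePi fun _ : ℕ => galtonWatson μ)).map graft = galtonWatson μ := by
  refine Measure.eq_infinitePi _ fun s t ht => ?_
  have hf : Set.InjOn (fun p : ℕ × List ℕ => p.1 :: p.2)
      ((fun p : ℕ × List ℕ => p.1 :: p.2) ⁻¹' (s : Set (List ℕ))) := by
    intro p _ q _ h
    simpa [Prod.ext_iff] using h
  set s' := s.preimage (fun p : ℕ × List ℕ => p.1 :: p.2) hf with hs'
  have hset : graft ⁻¹' (Set.pi s t) = (if [] ∈ s then t [] else Set.univ) ×ˢ
      ((MeasurableEquiv.curry ℕ (List ℕ) ℕ).symm ⁻¹'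
        (Set.pi (s' : Set (ℕ × List ℕ)) fun p => t (p.1 :: p.2))) := by
    ext ⟨n, d⟩
    simp only [Set.mem_preimage, Set.mem_pi, Set.mem_prod, Finset.mem_coe, hs',
      Finset.mem_preimage]
    constructor
    · intro h
      refine ⟨?_, fun p hp => h _ hp⟩
      split_ifs with h0
      · exact h _ h0
      · trivial
    · rintro ⟨h0, h1⟩ w hw
      cases w with
      | nil => simpa [hw, graft] using h0
      | cons j w => exact h1 (j, w) hw
  have hm : MeasurableSet (Set.pi (s' : Set (ℕ × List ℕ)) fun p => t (p.1 :: p.2)) :=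
    MeasurableSet.pi (Finset.countable_toSet _) fun p _ => ht _
  rw [Measure.map_apply measurable_graft
    (MeasurableSet.pi (Finset.countable_toSet _) fun p _ => ht _), hset, Measure.prod_prod,
    ← Measure.map_apply (MeasurableEquiv.measurable _) hm]
  unfold galtonWatson
  rw [Measure.infinitePi_map_curry_symm (fun (_ : ℕ) (_ : List ℕ) => μ),
    Measure.infinitePi_pi _ fun _ _ => ht _, prod_words_eq s _ hf]
  congr 1
  split_ifs <;> simp

/-- The integral of a product of functions of independent copies. -/
lemma integral_prod_infinitePi {E : Type*} [MeasurableSpace E] (ν : Measure E)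
    [IsProbabilityMeasure ν] (s : Finset ℕ) {φ : E → ℝ} (hφ : Measurable φ) :
    ∫ d, ∏ j ∈ s, φ (d j) ∂(Measure.infinitePi fun _ : ℕ => ν) = (∫ x, φ x ∂ν) ^ s.card := by
  have h := integral_restrict_infinitePi (μ := fun _ : ℕ => ν) (s := s)
    (f := fun y => ∏ j, φ (y j)) (by
      exact (Finset.measurable_fun_prod _ fun j _ =>
        hφ.comp (measurable_pi_apply j)).aestronglyMeasurable)
  rw [integral_fintype_prod_eq_prod (𝕜 := ℝ) (fun (_ : s) => φ)] at h
  simp only [Finset.prod_const, Finset.card_univ, Fintype.card_coe] at h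
  rw [← h]
  refine integral_congr_ae (ae_of_all _ fun d => ?_)
  simp only [Finset.restrict]
  exact (Finset.prod_coe_sort s fun j => φ (d j)).symm

/-- The probability generating function of `μ`. -/
noncomputable def pgf (μ : Measure ℕ) (t : ℝ) : ℝ := ∫ n, t ^ n ∂μ

lemma integrable_pow_comp {E : Type*} [MeasurableSpace E] (ν : Measure E) [IsFiniteMeasure ν]
    {s : ℝ} (h0 : 0 ≤ s) (h1 : s ≤ 1) {X : E → ℕ} (hX : Measurable X) :
    Integrable (fun x => s ^ X x) ν := by
  refine Integrable.of_bound (C := 1) (Measurable.aestronglyMeasurable ?_) (ae_of_all _ fun x => ?_)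
  · exact (Measurable.of_discrete (f := fun n : ℕ => s ^ n)).comp hX
  · rw [Real.norm_of_nonneg (pow_nonneg h0 _)]
    exact pow_le_one₀ h0 h1

/-- The branching property, for the generating function of `branchSum`. -/
lemma integral_pow_branchSum_succ (μ : Measure ℕ) [IsProbabilityMeasure μ] (a b h : ℕ) {s : ℝ}
    (h0 : 0 ≤ s) (h1 : s ≤ 1) :
    ∫ c, s ^ branchSum a b (h + 1) c ∂(galtonWatson μ) =
      s ^ a * pgf μ (∫ c, s ^ branchSum a b h c ∂(galtonWatson μ)) := by
  have hm (k : ℕ) : Measurable fun c : List ℕ → ℕ => s ^ branchSum a b k c :=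
    (Measurable.of_discrete (f := fun n : ℕ => s ^ n)).comp (measurable_branchSum a b k)
  conv_lhs => rw [← map_graft μ]
  rw [integral_map measurable_graft.aemeasurable (hm _).aestronglyMeasurable, integral_prod]
  · simp only [branchSum_graft, pow_add, integral_const_mul, ← Finset.prod_pow_eq_pow_sum]
    congr 1
    refine integral_congr_ae (ae_of_all _ fun n => ?_)
    simp only
    rw [integral_prod_infinitePi _ _ (hm h), Finset.card_range]
  · exact integrable_pow_comp _ h0 h1 ((measurable_branchSum _ _ _).comp measurable_graft)

/-- In the critical case every generation has mean size `1`. -/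
lemma lintegral_branchSum (μ : Measure ℕ) [IsProbabilityMeasure μ] (hμ : ∫⁻ n, (n : ENNReal) ∂μ = 1)
    (a b h : ℕ) : ∫⁻ c, (branchSum a b h c : ENNReal) ∂(galtonWatson μ) = a * h + b := by
  have hm (k : ℕ) : Measurable fun c : List ℕ → ℕ => (branchSum a b k c : ENNReal) :=
    (Measurable.of_discrete (f := fun n : ℕ => (n : ENNReal))).comp (measurable_branchSum a b k)
  induction h with
  | zero => simp [branchSum]
  | succ h ih =>
    have hg : Measurable fun x => (branchSum a b (h + 1) (graft x) : ENNReal) :=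
      (hm (h + 1)).comp measurable_graft
    conv_lhs => rw [← map_graft μ]
    rw [lintegral_map (hm _) measurable_graft, lintegral_prod _ hg.aemeasurable]
    have key (n : ℕ) : ∫⁻ d, (branchSum a b (h + 1) (graft (n, d)) : ENNReal)
        ∂(Measure.infinitePi fun _ : ℕ => galtonWatson μ) = a + n * (a * h + b) := by
      have hj (j : ℕ) : Measurable fun d : ℕ → List ℕ → ℕ => (branchSum a b h (d j) : ENNReal) :=
        (hm h).comp (measurable_pi_apply j)
      simp only [branchSum_graft, Nat.cast_add, Nat.cast_sum]
      rw [lintegral_add_left measurable_const, lintegral_finsetSum _ fun j _ => hj j]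
      simp only [lintegral_const, measure_univ, mul_one]
      congr 1
      rw [Finset.sum_congr rfl fun j _ => (lintegral_map (hm h) (measurable_pi_apply j)).symm]
      simp [Measure.infinitePi_map_eval, ih, mul_add]
    simp only [key]
    rw [lintegral_add_left measurable_const, lintegral_mul_const _ Measurable.of_discrete, hμ]
    simp only [lintegral_const, measure_univ]
    push_cast
    ring

/-! ### Generating function near 1, survival and total size. -/

lemma one_sub_add_sq_le_pow {q : ℝ} (h0 : 0 ≤ q) (h1 : q ≤ 1) (n : ℕ) :
    1 - n * q + (if 2 ≤ n then q ^ 2 else 0) ≤ (1 - q) ^ n := by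
  induction n with
  | zero => simp
  | succ n ih =>
    rcases n with _ | _ | n
    · simp
    · norm_num; nlinarith
    · have h2 : (2 : ℕ) ≤ n + 1 + 1 := by omega
      have h3 : (2 : ℕ) ≤ n + 1 + 1 + 1 := by omega
      rw [if_pos h2] at ih
      rw [if_pos h3, pow_succ (1 - q)]
      have h4 : (1 - q) ^ (n + 1 + 1) ≤ 1 := pow_le_one₀ (by linarith) (by linarith)
      push_cast at *
      nlinarith

lemma pow_le_one_sub_add_sq {q : ℝ} (h0 : 0 ≤ q) (h1 : q ≤ 1) (n : ℕ) :
    (1 - q) ^ n ≤ 1 - n * q + n ^ 2 * q ^ 2 := by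
  induction n with
  | zero => simp
  | succ n ih =>
    have hn : (0 : ℝ) ≤ n := n.cast_nonneg
    have h2 : (1 - q) ^ (n + 1) ≤ (1 - n * q + n ^ 2 * q ^ 2) * (1 - q) := by
      rw [pow_succ]
      exact mul_le_mul_of_nonneg_right ih (by linarith)
    push_cast
    nlinarith [mul_nonneg hn (sq_nonneg q), mul_nonneg (sq_nonneg (n : ℝ)) (pow_nonneg h0 3),
      sq_nonneg q]

section pgf

variable (μ : Measure ℕ) [IsProbabilityMeasure μ]

lemma integrable_cast (hvar : MemLp (fun k : ℕ => (k : ℝ)) 2 μ) :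
    Integrable (fun k : ℕ => (k : ℝ)) μ := hvar.integrable (by norm_num)

lemma lintegral_cast_eq_one (hvar : MemLp (fun k : ℕ => (k : ℝ)) 2 μ)
    (hmean : ∫ k : ℕ, (k : ℝ) ∂μ = 1) : ∫⁻ n, (n : ENNReal) ∂μ = 1 := by
  have h := ofReal_integral_eq_lintegral_ofReal (integrable_cast μ hvar)
    (ae_of_all _ fun k => Nat.cast_nonneg k)
  rw [hmean, ENNReal.ofReal_one] at h
  simpa using h.symm

/-- Otherwise 1 - n is almost surely nonnegative with mean zero, hence vanishes almost surely. -/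
lemma measureReal_two_le_pos (hne : μ ≠ Measure.dirac 1)
    (hvar : MemLp (fun k : ℕ => (k : ℝ)) 2 μ) (hmean : ∫ k : ℕ, (k : ℝ) ∂μ = 1) :
    0 < μ.real {n | 2 ≤ n} := by
  by_contra hpos
  have h0 : μ {n | 2 ≤ n} = 0 := by
    rw [← measureReal_eq_zero_iff]
    exact le_antisymm (not_lt.1 hpos) measureReal_nonneg
  have h2 : ∀ᵐ n ∂μ, n < 2 := by
    rw [ae_iff]
    simpa only [not_lt] using h0
  have h1 : ∀ᵐ n : ℕ ∂μ, (1 : ℝ) - n = 0 := by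
    have hnn : 0 ≤ᵐ[μ] fun n : ℕ => (1 : ℝ) - n := by
      filter_upwards [h2] with n hn
      have : (n : ℝ) ≤ 1 := by exact_mod_cast Nat.lt_succ_iff.1 hn
      simpa using this
    refine (integral_eq_zero_iff_of_nonneg_ae hnn
      ((integrable_const 1).sub (integrable_cast μ hvar))).1 ?_
    rw [integral_sub (integrable_const 1) (integrable_cast μ hvar), hmean]
    simp
  apply hne
  have h3 : ∀ᵐ n ∂μ, n = 1 := by
    filter_upwards [h1] with n hn
    have : (n : ℝ) = 1 := by linarith
    exact_mod_cast this
  calc μ = μ.map id := Measure.map_id.symm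
    _ = μ.map fun _ => 1 := Measure.map_congr h3
    _ = Measure.dirac 1 := by simp [Measure.map_const]

/-- The pointwise bound on (1 - q)^n is integrated, with mean 1 fixing the linear term. The
quadratic gain drives extinction. -/
lemma le_pgf (hvar : MemLp (fun k : ℕ => (k : ℝ)) 2 μ) (hmean : ∫ k : ℕ, (k : ℝ) ∂μ = 1)
    {q : ℝ} (h0 : 0 ≤ q) (h1 : q ≤ 1) :
    1 - q + μ.real {n | 2 ≤ n} * q ^ 2 ≤ pgf μ (1 - q) := by
  have hi1 : Integrable (fun n : ℕ => 1 - (n : ℝ) * q) μ :=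
    (integrable_const 1).sub ((integrable_cast μ hvar).mul_const q)
  have hi2 : Integrable ({n : ℕ | 2 ≤ n}.indicator fun _ => q ^ 2) μ :=
    (integrable_const _).indicator .of_discrete
  calc 1 - q + μ.real {n | 2 ≤ n} * q ^ 2
      = ∫ n, ((1 - (n : ℝ) * q) + {n : ℕ | 2 ≤ n}.indicator (fun _ => q ^ 2) n) ∂μ := by
        rw [integral_add hi1 hi2, integral_indicator_const _ .of_discrete,
          integral_sub (integrable_const 1) ((integrable_cast μ hvar).mul_const q),
          integral_mul_const, hmean]
        simp
    _ ≤ pgf μ (1 - q) := by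
        refine integral_mono (hi1.add hi2)
          (integrable_pow_comp μ (by linarith) (by linarith) measurable_id) fun n => ?_
        simpa [Set.indicator_apply] using one_sub_add_sq_le_pow h0 h1 n

lemma pgf_le (hvar : MemLp (fun k : ℕ => (k : ℝ)) 2 μ) (hmean : ∫ k : ℕ, (k : ℝ) ∂μ = 1)
    {q : ℝ} (h0 : 0 ≤ q) (h1 : q ≤ 1) :
    pgf μ (1 - q) ≤ 1 - q + (∫ n : ℕ, (n : ℝ) ^ 2 ∂μ) * q ^ 2 := by
  have hi1 : Integrable (fun n : ℕ => 1 - (n : ℝ) * q) μ :=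
    (integrable_const 1).sub ((integrable_cast μ hvar).mul_const q)
  have hi2 : Integrable (fun n : ℕ => (n : ℝ) ^ 2 * q ^ 2) μ := hvar.integrable_sq.mul_const _
  calc pgf μ (1 - q) ≤ ∫ n, ((1 - (n : ℝ) * q) + (n : ℝ) ^ 2 * q ^ 2) ∂μ :=
        integral_mono (integrable_pow_comp μ (by linarith) (by linarith) measurable_id)
          (hi1.add hi2) fun n => pow_le_one_sub_add_sq h0 h1 n
    _ = _ := by
        rw [integral_add hi1 hi2, integral_mul_const,
          integral_sub (integrable_const 1) ((integrable_cast μ hvar).mul_const q),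
          integral_mul_const, hmean]
        simp

lemma integral_pow_mem_Icc {E : Type*} [MeasurableSpace E] (ν : Measure E) [IsProbabilityMeasure ν]
    {s : ℝ} (h0 : 0 ≤ s) (h1 : s ≤ 1) {X : E → ℕ} (hX : Measurable X) :
    ∫ x, s ^ X x ∂ν ∈ Set.Icc (0 : ℝ) 1 := by
  refine ⟨integral_nonneg fun x => pow_nonneg h0 _, ?_⟩
  calc ∫ x, s ^ X x ∂ν ≤ ∫ _, (1 : ℝ) ∂ν :=
        integral_mono (integrable_pow_comp ν h0 h1 hX) (integrable_const 1)
          fun x => pow_le_one₀ h0 h1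
    _ = 1 := by simp

/-- Kolmogorov's upper bound for the probability that generation `h` is not empty. -/
lemma measureReal_survival_le (hvar : MemLp (fun k : ℕ => (k : ℝ)) 2 μ)
    (hmean : ∫ k : ℕ, (k : ℝ) ∂μ = 1) (h : ℕ) :
    (galtonWatson μ).real {c | branchSum 0 1 h c ≠ 0} ≤
      1 / (1 + μ.real {n | 2 ≤ n} * h) := by
  set p := μ.real {n | 2 ≤ n} with hp
  have hp0 : 0 ≤ p := measureReal_nonneg
  -- Since 0^0 = 1, the integral is the extinction probability. The survival probability q becomes
  -- at most q - pq² ≤ q/(1 + pq), so its inverse grows by at least p per generation.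
  have key (h : ℕ) : 1 - ∫ c, (0 : ℝ) ^ branchSum 0 1 h c ∂(galtonWatson μ) ≤ 1 / (1 + p * h) := by
    induction h with
    | zero => simp [branchSum]
    | succ h ih =>
      rw [integral_pow_branchSum_succ μ 0 1 h le_rfl zero_le_one]
      obtain ⟨g0, g1⟩ := integral_pow_mem_Icc (galtonWatson μ) (le_refl (0 : ℝ)) zero_le_one
        (measurable_branchSum 0 1 h)
      set q := 1 - ∫ c, (0 : ℝ) ^ branchSum 0 1 h c ∂(galtonWatson μ) with hq
      rw [show ∫ c, (0 : ℝ) ^ branchSum 0 1 h c ∂(galtonWatson μ) = 1 - q by rw [hq]; ring]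
      have hq0 : 0 ≤ q := by linarith
      have hq1 : q ≤ 1 := by linarith
      have h1 := le_pgf μ hvar hmean hq0 hq1
      rw [← hp] at h1
      have hpq : 0 ≤ p * q := mul_nonneg hp0 hq0
      have hden : 0 < 1 + p * (h : ℝ) := by positivity
      have h2 : q * (1 + p * h) ≤ 1 := by rwa [le_div_iff₀ hden] at ih
      have h3 : q - p * q ^ 2 ≤ q / (1 + p * q) := by
        rw [le_div_iff₀ (by positivity)]
        nlinarith [mul_nonneg hq0 (mul_nonneg hpq hpq)]
      have h4 : q / (1 + p * q) ≤ 1 / (1 + p * ((h + 1 : ℕ) : ℝ)) := by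
        rw [div_le_div_iff₀ (by positivity) (by positivity)]
        push_cast
        linarith
      rw [pow_zero, one_mul]
      linarith
  refine le_trans (le_of_eq ?_) (key h)
  have hset : MeasurableSet {c | branchSum 0 1 h c = 0} :=
    measurable_branchSum 0 1 h (MeasurableSet.singleton 0)
  have h5 : ∫ c, (0 : ℝ) ^ branchSum 0 1 h c ∂(galtonWatson μ) =
      (galtonWatson μ).real {c | branchSum 0 1 h c = 0} := by
    rw [← integral_indicator_one hset]
    refine integral_congr_ae (ae_of_all _ fun c => ?_)
    by_cases hc : branchSum 0 1 h c = 0 <;> simp [hc]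
  rw [h5, ← probReal_compl_eq_one_sub hset]
  rfl

/-- The Laplace transform of the tree size behaves at most like `1 - c √ε` near `ε = 0`. -/
lemma exists_integral_pow_size_le (hvar : MemLp (fun k : ℕ => (k : ℝ)) 2 μ)
    (hmean : ∫ k : ℕ, (k : ℝ) ∂μ = 1) :
    ∃ a : ℝ, 0 < a ∧ ∀ ε : ℝ, 0 < ε → ε ≤ 1 → ∃ h : ℕ,
      ∫ c, (1 - ε) ^ branchSum 1 0 h c ∂(galtonWatson μ) ≤ 1 - a * √ε := by
  set C := ∫ n : ℕ, (n : ℝ) ^ 2 ∂μ with hC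
  have hC0 : 0 ≤ C := integral_nonneg fun n => sq_nonneg _
  -- This constant a satisfies a ≤ 1/2 and C a² ≤ 1/4, which bounds the losses in the recursion
  -- below.
  refine ⟨1 / (2 * (C + 1)), by positivity, fun ε hε hε1 => ?_⟩
  set a := 1 / (2 * (C + 1)) with ha
  have ha0 : 0 < a := by positivity
  have ha1 : a ≤ 1 / 2 := by
    rw [ha, div_le_div_iff₀ (by positivity) (by norm_num)]; linarith
  have haC : C * a ^ 2 ≤ 1 / 4 := by
    have h1 : (C + 1) * a = 1 / 2 := by rw [ha]; field_simp
    nlinarith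
  by_contra hcon
  push Not at hcon
  -- While the deficit p stays below a√ε, one generation adds at least ε - εp - Cp² ≥ ε/4. This
  -- cannot go on forever, as p ≤ 1.
  have key (h : ℕ) : ε / 4 * h ≤ 1 - ∫ c, (1 - ε) ^ branchSum 1 0 h c ∂(galtonWatson μ) := by
    induction h with
    | zero => simp [branchSum]
    | succ h ih =>
      have hh := hcon h
      rw [integral_pow_branchSum_succ μ 1 0 h (by linarith) (by linarith)]
      obtain ⟨g0, g1⟩ := integral_pow_mem_Icc (galtonWatson μ) (s := 1 - ε) (by linarith)
        (by linarith) (measurable_branchSum 1 0 h)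
      set p := 1 - ∫ c, (1 - ε) ^ branchSum 1 0 h c ∂(galtonWatson μ) with hp
      rw [show ∫ c, (1 - ε) ^ branchSum 1 0 h c ∂(galtonWatson μ) = 1 - p by rw [hp]; ring]
        at hh ⊢
      have hp0 : 0 ≤ p := by linarith
      have hp1 : p ≤ 1 := by linarith
      have h1 := pgf_le μ hvar hmean hp0 hp1
      rw [← hC] at h1
      have hpa : p ≤ a * √ε := by linarith
      have hsq : p ^ 2 ≤ a ^ 2 * ε := by
        calc p ^ 2 ≤ (a * √ε) ^ 2 := by gcongr
          _ = a ^ 2 * ε := by rw [mul_pow, Real.sq_sqrt hε.le]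
      have hpC : C * p ^ 2 ≤ ε / 4 := by nlinarith
      have hs1 : √ε ≤ 1 := Real.sqrt_le_one.2 hε1
      have hph : p ≤ 1 / 2 := by nlinarith [Real.sqrt_nonneg ε]
      have h2 : (1 - ε) * pgf μ (1 - p) ≤ (1 - ε) * (1 - p + C * p ^ 2) :=
        mul_le_mul_of_nonneg_left h1 (by linarith)
      have h3 : 0 ≤ C * p ^ 2 := by positivity
      push_cast
      rw [pow_one]
      nlinarith
  obtain ⟨h, hh⟩ := exists_nat_gt (1 / (ε / 4))
  have h1 := key h
  obtain ⟨g0, g1⟩ := integral_pow_mem_Icc (galtonWatson μ) (s := 1 - ε) (by linarith)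
    (by linarith) (measurable_branchSum 1 0 h)
  rw [div_lt_iff₀ (by positivity)] at hh
  linarith

end pgf

/-! ### Probability estimates for the sequence of trees. -/

section forest

variable (μ : Measure ℕ) [IsProbabilityMeasure μ]

/-- The law of the child counts of a sequence of independent Galton–Watson trees. -/
noncomputable def forestLaw : Measure (ℕ → List ℕ → ℕ) :=
  Measure.infinitePi fun _ : ℕ => galtonWatson μ

instance : IsProbabilityMeasure (forestLaw μ) := by
  unfold forestLaw; infer_instance

lemma forestLaw_map_eval (k : ℕ) : (forestLaw μ).map (fun c => c k) = galtonWatson μ :=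
  Measure.infinitePi_map_eval (fun _ : ℕ => galtonWatson μ) k

lemma measurable_sum_branchSum (a b m h : ℕ) :
    Measurable fun c : ℕ → List ℕ → ℕ => ∑ k ∈ Finset.range m, branchSum a b h (c k) :=
  Finset.measurable_fun_sum _ fun k _ => (measurable_branchSum a b h).comp (measurable_pi_apply k)

/-- The first moment bound for the number of vertices in the first `h` trees and generations. -/
lemma measureReal_lt_sum_size_le (hvar : MemLp (fun k : ℕ => (k : ℝ)) 2 μ)
    (hmean : ∫ k : ℕ, (k : ℝ) ∂μ = 1) {n : ℕ} (hn : n ≠ 0) (h : ℕ) :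
    (forestLaw μ).real {c | n < ∑ k ∈ Finset.range h, branchSum 1 0 h (c k)} ≤
      (h : ℝ) ^ 2 / n := by
  have hm (k : ℕ) : Measurable fun c : ℕ → List ℕ → ℕ => (branchSum 1 0 h (c k) : ENNReal) :=
    (Measurable.of_discrete (f := fun n : ℕ => (n : ENNReal))).comp
      ((measurable_branchSum 1 0 h).comp (measurable_pi_apply k))
  have hint : ∫⁻ c, ((∑ k ∈ Finset.range h, branchSum 1 0 h (c k) : ℕ) : ENNReal) ∂(forestLaw μ)
      = h * h := by
    simp only [Nat.cast_sum]
    rw [lintegral_finsetSum _ fun k _ => hm k]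
    have hk (k : ℕ) : ∫⁻ c, (branchSum 1 0 h (c k) : ENNReal) ∂(forestLaw μ) = h := by
      have h1 := lintegral_branchSum μ (lintegral_cast_eq_one μ hvar hmean) 1 0 h
      have h2 : Measurable fun c : List ℕ → ℕ => (branchSum 1 0 h c : ENNReal) :=
        (Measurable.of_discrete (f := fun n : ℕ => (n : ENNReal))).comp (measurable_branchSum 1 0 h)
      have h3 : Measurable fun c : ℕ → List ℕ → ℕ => c k := measurable_pi_apply k
      rw [← forestLaw_map_eval μ k, lintegral_map h2 h3] at h1
      simpa using h1
    simp [hk]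
  have hmark := meas_ge_le_lintegral_div (μ := forestLaw μ)
    (Finset.measurable_fun_sum (Finset.range h) fun k _ => hm k).aemeasurable
    (ε := (n : ENNReal)) (by exact_mod_cast hn) (ENNReal.natCast_ne_top n)
  simp only [← Nat.cast_sum] at hmark
  rw [hint] at hmark
  have hsub : (forestLaw μ) {c | n < ∑ k ∈ Finset.range h, branchSum 1 0 h (c k)} ≤
      (h : ENNReal) * h / n := by
    refine (measure_mono fun c hc => ?_).trans hmark
    simp only [Set.mem_ofPred_eq, Nat.cast_le] at hc ⊢
    exact hc.le
  have hfin : (h : ENNReal) * h / n ≠ ⊤ :=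
    ENNReal.div_ne_top (ENNReal.mul_ne_top (ENNReal.natCast_ne_top h) (ENNReal.natCast_ne_top h))
      (by exact_mod_cast hn)
  have := ENNReal.toReal_mono hfin hsub
  rw [ENNReal.toReal_div, ENNReal.toReal_mul] at this
  simpa [Measure.real, sq] using this

/-- Some of the first `m` trees survives up to generation `h` with probability at most `O(m / h)`. -/
lemma measureReal_exists_survival_le (hne : μ ≠ Measure.dirac 1)
    (hvar : MemLp (fun k : ℕ => (k : ℝ)) 2 μ) (hmean : ∫ k : ℕ, (k : ℝ) ∂μ = 1) (m : ℕ) {h : ℕ}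
    (hh : h ≠ 0) :
    (forestLaw μ).real {c | ∃ k < m, branchSum 0 1 h (c k) ≠ 0} ≤
      1 / μ.real {n | 2 ≤ n} * (m / h) := by
  have hp := measureReal_two_le_pos μ hne hvar hmean
  set p := μ.real {n | 2 ≤ n}
  have hh0 : (0 : ℝ) < h := by exact_mod_cast Nat.pos_of_ne_zero hh
  have hset : {c : ℕ → List ℕ → ℕ | ∃ k < m, branchSum 0 1 h (c k) ≠ 0} =
      ⋃ k ∈ Finset.range m, {c | branchSum 0 1 h (c k) ≠ 0} := by
    ext c; simp
  have hk (k : ℕ) : (forestLaw μ).real {c | branchSum 0 1 h (c k) ≠ 0} ≤ 1 / (p * h) := by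
    have h1 := measureReal_survival_le μ hvar hmean h
    have hms : MeasurableSet {c | branchSum 0 1 h c ≠ 0} :=
      measurable_branchSum 0 1 h (MeasurableSet.singleton 0).compl
    rw [← forestLaw_map_eval μ k, map_measureReal_apply (measurable_pi_apply k) hms] at h1
    refine le_trans h1 ?_
    change 1 / (1 + p * h) ≤ _
    exact one_div_le_one_div_of_le (by positivity) (by linarith)
  rw [hset]
  calc _ ≤ ∑ k ∈ Finset.range m, (forestLaw μ).real {c | branchSum 0 1 h (c k) ≠ 0} :=
        measureReal_biUnion_finset_le _ _
    _ ≤ ∑ k ∈ Finset.range m, 1 / (p * h) := Finset.sum_le_sum fun k _ => hk k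
    _ = 1 / p * (m / h) := by
        simp only [Finset.sum_const, Finset.card_range, nsmul_eq_mul]
        field_simp

/-- The first `m` trees have at most `n` vertices in total with probability at most `O(√n / m)`. -/
lemma exists_measureReal_sum_size_le (hvar : MemLp (fun k : ℕ => (k : ℝ)) 2 μ)
    (hmean : ∫ k : ℕ, (k : ℝ) ∂μ = 1) :
    ∃ C : ℝ, 0 < C ∧ ∀ n m : ℕ, n ≠ 0 → m ≠ 0 → ∃ h : ℕ,
      (forestLaw μ).real {c | ∑ k ∈ Finset.range m, branchSum 1 0 h (c k) ≤ n} ≤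
        C * (√n / m) := by
  obtain ⟨a, ha, hsize⟩ := exists_integral_pow_size_le μ hvar hmean
  refine ⟨4 / a, by positivity, fun n m hn hm => ?_⟩
  have hn0 : (0 : ℝ) < n := by exact_mod_cast Nat.pos_of_ne_zero hn
  have hn1 : (1 : ℝ) ≤ n := by exact_mod_cast Nat.one_le_iff_ne_zero.2 hn
  have hm0 : (0 : ℝ) < m := by exact_mod_cast Nat.pos_of_ne_zero hm
  -- At this scale (1 - ε)^n ≥ 1/2 by Bernoulli's inequality, while √ε is of order 1/√n.
  set ε : ℝ := 1 / (4 * n) with hε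
  have hε0 : 0 < ε := by positivity
  have hε1 : ε ≤ 1 / 4 := by
    rw [hε, div_le_div_iff₀ (by positivity) (by norm_num)]; linarith
  have hsqrt : √ε = 1 / (2 * √n) := by
    rw [hε, Real.sqrt_div zero_le_one, Real.sqrt_one, Real.sqrt_mul (by norm_num),
      show (4 : ℝ) = 2 ^ 2 by norm_num, Real.sqrt_sq (by norm_num)]
  obtain ⟨h, hh⟩ := hsize ε hε0 (by linarith)
  refine ⟨h, ?_⟩
  set s := 1 - ε with hs
  have hs0 : 0 ≤ s := by linarith
  have hs1 : s ≤ 1 := by linarith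
  set S : (ℕ → List ℕ → ℕ) → ℕ := fun c => ∑ k ∈ Finset.range m, branchSum 1 0 h (c k) with hS
  have hSm : Measurable S := measurable_sum_branchSum 1 0 m h
  have hlap : ∫ c, s ^ S c ∂(forestLaw μ) ≤ Real.exp (-(a * √ε * m)) := by
    simp only [hS, ← Finset.prod_pow_eq_pow_sum]
    unfold forestLaw
    rw [integral_prod_infinitePi (galtonWatson μ) (Finset.range m)
      (φ := fun c => s ^ branchSum 1 0 h c) ((Measurable.of_discrete
        (f := fun n : ℕ => s ^ n)).comp (measurable_branchSum 1 0 h)), Finset.card_range]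
    calc _ ≤ Real.exp (-(a * √ε)) ^ m := by
          refine pow_le_pow_left₀ (integral_nonneg fun c => pow_nonneg hs0 _) (hh.trans ?_) m
          have := Real.add_one_le_exp (-(a * √ε))
          linarith
      _ = _ := by rw [← Real.exp_nat_mul]; ring_nf
  have hsn : 1 / 2 ≤ s ^ n := by
    have h1 := one_add_mul_le_pow (a := -ε) (by linarith) n
    have h2 : (n : ℝ) * ε = 1 / 4 := by rw [hε]; field_simp
    rw [hs, sub_eq_add_neg]
    linarith
  have hmark : 1 / 2 * (forestLaw μ).real {c | S c ≤ n} ≤ ∫ c, s ^ S c ∂(forestLaw μ) := by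
    refine le_trans ?_ (mul_meas_ge_le_integral_of_nonneg
      (ae_of_all _ fun c => pow_nonneg hs0 _) (integrable_pow_comp _ hs0 hs1 hSm) (1 / 2))
    refine mul_le_mul_of_nonneg_left (measureReal_mono fun c hc => ?_) (by norm_num)
    exact hsn.trans (pow_le_pow_of_le_one hs0 hs1 hc)
  have hx : 0 < a * √ε * m := by rw [hsqrt]; positivity
  have hexp : Real.exp (-(a * √ε * m)) ≤ 1 / (a * √ε * m) := by
    rw [Real.exp_neg, ← one_div]
    exact one_div_le_one_div_of_le hx (by linarith [Real.add_one_le_exp (a * √ε * m)])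
  have hfin : 1 / (a * √ε * m) = 1 / 2 * (4 / a * (√n / m)) := by
    rw [hsqrt]; field_simp; norm_num
  linarith

/-- Borel–Cantelli along a geometrically decaying sequence of probabilities. -/
lemma ae_eventually_notMem_of_geometric {E : Type*} [MeasurableSpace E] (ν : Measure E)
    [IsFiniteMeasure ν] {s : ℕ → Set E} {C r : ℝ} (hr0 : 0 ≤ r) (hr1 : r < 1)
    (h : ∀ j, ν.real (s j) ≤ C * r ^ j) : ∀ᵐ x ∂ν, ∀ᶠ j in atTop, x ∉ s j := by
  refine ae_eventually_notMem ?_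
  have hsum : Summable fun j => ν.real (s j) :=
    Summable.of_nonneg_of_le (fun _ => measureReal_nonneg) h
      ((summable_geometric_of_lt_one hr0 hr1).mul_left C)
  have h1 : (fun j => ν (s j)) = fun j => ENNReal.ofReal (ν.real (s j)) := by
    ext j; rw [ofReal_measureReal]
  rw [h1]
  exact hsum.tsum_ofReal_ne_top

/-- The properties of the child counts that determine the growth of the forest up to a factor
`θ ^ j` at the time `4 ^ j`. -/
def GrowthAt (c : ℕ → List ℕ → ℕ) (θ : ℝ) (j : ℕ) : Prop :=
  (∑ k ∈ Finset.range ⌈(2 / θ) ^ j⌉₊, branchSum 1 0 ⌈(2 / θ) ^ j⌉₊ (c k) ≤ 4 ^ j) ∧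
  (∃ h, 4 ^ j < ∑ k ∈ Finset.range ⌈(2 * θ) ^ j⌉₊, branchSum 1 0 h (c k)) ∧
  ∀ k < ⌈(2 * θ) ^ j⌉₊, branchSum 0 1 ⌈(2 * θ ^ 2) ^ j⌉₊ (c k) = 0

lemma ceil_le_two_mul_of_one_le {x : ℝ} (hx : 1 ≤ x) : (⌈x⌉₊ : ℝ) ≤ 2 * x := by
  have := Nat.ceil_lt_add_one (show 0 ≤ x by linarith)
  linarith

lemma ae_eventually_growthAt (hne : μ ≠ Measure.dirac 1)
    (hvar : MemLp (fun k : ℕ => (k : ℝ)) 2 μ) (hmean : ∫ k : ℕ, (k : ℝ) ∂μ = 1) {θ : ℝ}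
    (h1 : 1 < θ) (h2 : θ ≤ 2) : ∀ᵐ c ∂(forestLaw μ), ∀ᶠ j in atTop, GrowthAt c θ j := by
  have h0 : 0 < θ := by linarith
  have hr0 : 0 ≤ 1 / θ := by positivity
  have hr1 : 1 / θ < 1 := (div_lt_one h0).2 h1
  -- Bases at least 1 ensure that rounding up costs at most a factor 2; here θ ≤ 2 is needed.
  have hlow (j : ℕ) : (1 : ℝ) ≤ (2 / θ) ^ j := one_le_pow₀ ((one_le_div h0).2 h2)
  have hmid (j : ℕ) : (1 : ℝ) ≤ (2 * θ) ^ j := one_le_pow₀ (by linarith)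
  have hupp (j : ℕ) : (1 : ℝ) ≤ (2 * θ ^ 2) ^ j := one_le_pow₀ (by nlinarith)
  have A := ae_eventually_notMem_of_geometric (forestLaw μ)
    (s := fun j => {c | 4 ^ j < ∑ k ∈ Finset.range ⌈(2 / θ) ^ j⌉₊,
      branchSum 1 0 ⌈(2 / θ) ^ j⌉₊ (c k)}) (C := 4) (r := 1 / θ) hr0 hr1 (by
    intro j
    refine (measureReal_lt_sum_size_le μ hvar hmean (by positivity) _).trans ?_
    have hc := ceil_le_two_mul_of_one_le (hlow j)
    calc (⌈(2 / θ) ^ j⌉₊ : ℝ) ^ 2 / ((4 ^ j : ℕ) : ℝ) ≤ (2 * (2 / θ) ^ j) ^ 2 / ((4 ^ j : ℕ) : ℝ) := by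
          gcongr
      _ = 4 * ((1 / θ) ^ j * (1 / θ) ^ j) := by
          push_cast
          rw [show (4 : ℝ) ^ j = 2 ^ j * 2 ^ j by rw [← mul_pow]; norm_num]
          simp only [div_pow, one_pow]
          field_simp
          norm_num
      _ ≤ 4 * (1 / θ) ^ j := by
          have : (1 / θ) ^ j ≤ 1 := pow_le_one₀ hr0 hr1.le
          nlinarith [pow_nonneg hr0 j])
  obtain ⟨C, hC, hsize⟩ := exists_measureReal_sum_size_le μ hvar hmean
  choose H hH using fun j : ℕ => hsize (4 ^ j) ⌈(2 * θ) ^ j⌉₊ (by positivity)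
    (Nat.ceil_pos.2 (by positivity)).ne'
  have B := ae_eventually_notMem_of_geometric (forestLaw μ)
    (s := fun j => {c | ∑ k ∈ Finset.range ⌈(2 * θ) ^ j⌉₊, branchSum 1 0 (H j) (c k) ≤ 4 ^ j})
    (C := C) (r := 1 / θ) hr0 hr1 (by
    intro j
    refine (hH j).trans (mul_le_mul_of_nonneg_left ?_ hC.le)
    have hs : √((4 ^ j : ℕ) : ℝ) = 2 ^ j := by
      push_cast
      rw [show (4 : ℝ) ^ j = (2 ^ j) ^ 2 by rw [← pow_mul, mul_comm, pow_mul]; norm_num,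
        Real.sqrt_sq (by positivity)]
    rw [hs]
    calc (2 : ℝ) ^ j / ⌈(2 * θ) ^ j⌉₊ ≤ 2 ^ j / (2 * θ) ^ j := by
          gcongr
          exact Nat.le_ceil _
      _ = (1 / θ) ^ j := by rw [mul_pow, one_div, inv_pow]; field_simp)
  have D := ae_eventually_notMem_of_geometric (forestLaw μ)
    (s := fun j => {c | ∃ k < ⌈(2 * θ) ^ j⌉₊, branchSum 0 1 ⌈(2 * θ ^ 2) ^ j⌉₊ (c k) ≠ 0})
    (C := 1 / μ.real {n | 2 ≤ n} * 2) (r := 1 / θ) hr0 hr1 (by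
    intro j
    refine (measureReal_exists_survival_le μ hne hvar hmean _
      (Nat.ceil_pos.2 (by positivity)).ne').trans ?_
    rw [mul_assoc]
    refine mul_le_mul_of_nonneg_left ?_ (by positivity)
    calc (⌈(2 * θ) ^ j⌉₊ : ℝ) / ⌈(2 * θ ^ 2) ^ j⌉₊ ≤ (2 * (2 * θ) ^ j) / (2 * θ ^ 2) ^ j := by
          gcongr
          · exact ceil_le_two_mul_of_one_le (hmid j)
          · exact Nat.le_ceil _
      _ = 2 * (1 / θ) ^ j := by
          rw [mul_pow, mul_pow, one_div, inv_pow, ← pow_mul, mul_comm 2 j, pow_mul]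
          field_simp)
  filter_upwards [A, B, D] with c hA hB hD
  filter_upwards [hA, hB, hD] with j hA hB hD
  refine ⟨not_lt.1 hA, ⟨H j, not_le.1 hB⟩, fun k hk => ?_⟩
  by_contra hcon
  exact hD ⟨k, hk, hcon⟩

lemma hasLaw_forestLaw {Ω : Type*} [MeasurableSpace Ω] {P : Measure Ω}
    {ξ : ℕ → List ℕ → Ω → ℕ} (hlaw : ∀ k w, HasLaw (ξ k w) μ P)
    (hindep : iIndepFun (fun v : ℕ × List ℕ => ξ v.1 v.2) P) :
    HasLaw (fun ω k w => ξ k w ω) (forestLaw μ) P := by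
  have h1 : HasLaw (fun ω (v : ℕ × List ℕ) => ξ v.1 v.2 ω)
      (Measure.infinitePi fun _ : ℕ × List ℕ => μ) P :=
    hindep.hasLaw_infinitePi (fun v => hlaw v.1 v.2)
      (aemeasurable_pi_iff.2 fun v => (hlaw v.1 v.2).aemeasurable)
  have h2 : HasLaw (MeasurableEquiv.curry ℕ (List ℕ) ℕ) (forestLaw μ)
      (Measure.infinitePi fun _ : ℕ × List ℕ => μ) :=
    ⟨(MeasurableEquiv.measurable _).aemeasurable,
      Measure.infinitePi_map_curry fun (_ : ℕ) (_ : List ℕ) => μ⟩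
  exact h2.comp h1

end forest

/-! ### Truncated trees as finite sets of words. -/

lemma nil_mem_planeTree (c : List ℕ → ℕ) : [] ∈ planeTree c := fun p j h => by simp at h

lemma cons_mem_planeTree {c : List ℕ → ℕ} {j : ℕ} {w : List ℕ} :
    j :: w ∈ planeTree c ↔ j < c [] ∧ w ∈ planeTree fun w => c (j :: w) := by
  constructor
  · refine fun h => ⟨h [] j (by simp), fun p i hp => h (j :: p) i ?_⟩
    simpa using hp
  · rintro ⟨h0, h1⟩ p i hp
    cases p with
    | nil =>
      have : i = j := by simpa using hp
      rwa [this]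
    | cons a p =>
      simp only [List.cons_append, List.cons_prefix_cons] at hp
      obtain ⟨rfl, hp⟩ := hp
      exact h1 p i hp

/-- The vertices of the first `h` generations of a plane tree. -/
def truncTree : ℕ → (List ℕ → ℕ) → Finset (List ℕ)
  | 0, _ => ∅
  | h + 1, c => insert [] ((Finset.range (c [])).biUnion fun j =>
      (truncTree h fun w => c (j :: w)).image (List.cons j))

lemma mem_truncTree {h : ℕ} {c : List ℕ → ℕ} {w : List ℕ} :
    w ∈ truncTree h c ↔ w ∈ planeTree c ∧ w.length < h := by
  induction h generalizing c w with
  | zero => simp [truncTree]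
  | succ h ih =>
    cases w with
    | nil => simp [truncTree, nil_mem_planeTree]
    | cons j w =>
      simp only [truncTree, Finset.mem_insert, reduceCtorEq, Finset.mem_biUnion, Finset.mem_range,
        Finset.mem_image, ih, cons_mem_planeTree, List.cons.injEq, false_or, List.length_cons,
        Nat.add_lt_add_iff_right]
      constructor
      · rintro ⟨i, hi, v, ⟨hv, hl⟩, rfl, rfl⟩
        exact ⟨⟨hi, hv⟩, hl⟩
      · rintro ⟨⟨hj, hw⟩, hl⟩
        exact ⟨j, hj, w, ⟨hw, hl⟩, rfl, rfl⟩

lemma card_truncTree (h : ℕ) (c : List ℕ → ℕ) : (truncTree h c).card = branchSum 1 0 h c := by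
  induction h generalizing c with
  | zero => rfl
  | succ h ih =>
    simp only [truncTree, branchSum]
    rw [Finset.card_insert_of_notMem (by simp), Finset.card_biUnion, add_comm]
    · congr 1
      refine Finset.sum_congr rfl fun j _ => ?_
      rw [Finset.card_image_of_injective _ (List.cons_injective), ih]
    · intro i _ j _ hij
      rw [Function.onFun, Finset.disjoint_left]
      intro w hi hj
      simp only [Finset.mem_image] at hi hj
      obtain ⟨v, _, rfl⟩ := hi
      obtain ⟨v', _, h⟩ := hj
      exact hij (List.cons.inj h).1.symm

lemma length_lt_of_branchSum_eq_zero {h : ℕ} {c : List ℕ → ℕ} (hc : branchSum 0 1 h c = 0)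
    {w : List ℕ} (hw : w ∈ planeTree c) : w.length < h := by
  induction h generalizing c w with
  | zero => simp [branchSum] at hc
  | succ h ih =>
    cases w with
    | nil => simp
    | cons j w =>
      rw [cons_mem_planeTree] at hw
      simp only [branchSum, zero_add, Finset.sum_eq_zero_iff, Finset.mem_range] at hc
      simpa using ih (hc j hw.1) hw.2

/-! ### Graph distance to the root. -/

section distance

variable {c : ℕ → List ℕ → ℕ}

/-- The generation of a vertex of the forest, counted along the spine. -/
def forestHeight (v : ℕ ×ₗ List ℕ) : ℕ := (ofLex v).1 + (ofLex v).2.length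

lemma forestHeight_of_isParent {u v : ℕ ×ₗ List ℕ} (h : IsParent u v) :
    forestHeight v = forestHeight u + 1 := by
  rcases h with ⟨k, w, j, rfl, rfl⟩ | ⟨k, rfl, rfl⟩
  · simp [forestHeight]; omega
  · simp [forestHeight]

lemma forestHeight_le_length {u v : forest c} (p : (forestGraph c).Walk u v) :
    forestHeight (v : ℕ ×ₗ List ℕ) ≤ forestHeight (u : ℕ ×ₗ List ℕ) + p.length := by
  induction p with
  | nil => simp
  | cons h p ih =>
    rw [forestGraph, SimpleGraph.fromRel_adj] at h
    rw [SimpleGraph.Walk.length_cons]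
    rcases h.2 with h | h <;> have := forestHeight_of_isParent h <;> omega

lemma mem_planeTree_of_append {c : List ℕ → ℕ} {w v : List ℕ} (h : w ++ v ∈ planeTree c) :
    w ∈ planeTree c := fun p j hp => h p j (hp.trans (List.prefix_append _ _))

lemma forestGraph_adj_of_isParent {u v : forest c}
    (h : IsParent (u : ℕ ×ₗ List ℕ) (v : ℕ ×ₗ List ℕ)) : (forestGraph c).Adj u v := by
  rw [forestGraph, SimpleGraph.fromRel_adj]
  refine ⟨fun huv => ?_, Or.inl h⟩
  have := forestHeight_of_isParent h
  rw [huv] at this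
  omega

lemma exists_walk_spine (k : ℕ) : ∃ p : (forestGraph c).Walk (forestRoot c)
    ⟨toLex (k, []), nil_mem_planeTree (c k)⟩, p.length = k := by
  induction k with
  | zero => exact ⟨.nil, rfl⟩
  | succ k ih =>
    obtain ⟨p, hp⟩ := ih
    exact ⟨p.concat (forestGraph_adj_of_isParent (Or.inr ⟨k, rfl, rfl⟩)), by simp [hp]⟩

lemma exists_walk (k : ℕ) (w : List ℕ) (hw : w ∈ planeTree (c k)) :
    ∃ p : (forestGraph c).Walk (forestRoot c) ⟨toLex (k, w), hw⟩, p.length = k + w.length := by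
  induction w using List.reverseRecOn with
  | nil => exact exists_walk_spine k
  | append_singleton w j ih =>
    obtain ⟨p, hp⟩ := ih (mem_planeTree_of_append hw)
    refine ⟨p.concat (forestGraph_adj_of_isParent (Or.inl ⟨k, w, j, rfl, rfl⟩)), ?_⟩
    simp [hp, add_assoc]

/-- Following the spine and then the tree branch realises the height as a length. No walk is
shorter, because each edge changes the height by exactly one. -/
lemma dist_forestRoot (v : forest c) :
    (forestGraph c).dist (forestRoot c) v = forestHeight (v : ℕ ×ₗ List ℕ) := by
  obtain ⟨p, hp⟩ := exists_walk (c := c) (ofLex v.1).1 (ofLex v.1).2 v.2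
  refine le_antisymm ((SimpleGraph.dist_le p).trans hp.le) ?_
  obtain ⟨q, hq⟩ := p.reachable.exists_walk_length_eq_dist
  have := forestHeight_le_length q
  rw [hq] at this
  simpa [forestHeight, forestRoot] using this

end distance

/-! ### Depth-first enumeration. -/

section order

variable {c : ℕ → List ℕ → ℕ}

lemma nil_le_word (w : List ℕ) : [] ≤ w := by
  cases w with
  | nil => exact le_rfl
  | cons a w => exact le_of_lt List.Lex.nil

lemma forestRoot_le (v : forest c) : forestRoot c ≤ v := by
  change toLex (0, []) ≤ (v : ℕ ×ₗ List ℕ)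
  rw [Prod.Lex.le_iff]
  rcases Nat.eq_zero_or_pos (ofLex v.1).1 with h | h
  · exact Or.inr ⟨h.symm, nil_le_word _⟩
  · exact Or.inl h

lemma forest_lt_of_fst_lt {u v : forest c} (h : (ofLex u.1).1 < (ofLex v.1).1) : u < v := by
  change (u : ℕ ×ₗ List ℕ) < v
  rw [Prod.Lex.lt_iff]
  exact Or.inl h

lemma fst_le_of_forest_le {u v : forest c} (h : u ≤ v) : (ofLex u.1).1 ≤ (ofLex v.1).1 := by
  by_contra hcon
  exact absurd h (not_le.2 (forest_lt_of_fst_lt (not_le.1 hcon)))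

lemma forest_ext {u v : forest c}
    (h : (⟨(ofLex u.1).1, (ofLex u.1).2⟩ : Σ _ : ℕ, List ℕ) = ⟨(ofLex v.1).1, (ofLex v.1).2⟩) :
    u = v := by
  simp only [Sigma.mk.injEq, heq_eq_eq] at h
  exact Subtype.ext (ofLex_inj.1 (Prod.ext h.1 h.2))

/-- If all trees are finite then the vertices of the forest can be enumerated in order. -/
lemma nonempty_orderIso_forest (hfin : ∀ k, ∃ h, branchSum 0 1 h (c k) = 0) :
    Nonempty (ℕ ≃o forest c) := by
  choose H hH using hfin
  have hIic (v : forest c) : (Set.Iic v).Finite := by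
    -- Vertices up to `v` lie in finitely many trees, each cut at a height where it is already
    -- extinct.
    let B : Finset (Σ _ : ℕ, List ℕ) :=
      (Finset.range ((ofLex v.1).1 + 1)).sigma fun k => truncTree (H k) (c k)
    refine Set.Finite.of_injOn (t := (B : Set (Σ _ : ℕ, List ℕ)))
      (f := fun u : forest c => (⟨(ofLex u.1).1, (ofLex u.1).2⟩ : Σ _ : ℕ, List ℕ)) ?_ ?_
      (Finset.finite_toSet B)
    · intro u hu
      have h1 := fst_le_of_forest_le (Set.mem_Iic.1 hu)
      simp only [B, Finset.mem_coe, Finset.mem_sigma, Finset.mem_range, mem_truncTree]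
      exact ⟨by omega, u.2, length_lt_of_branchSum_eq_zero (hH _) u.2⟩
    · intro u _ v _ h
      exact forest_ext h
  -- A nonempty locally finite linear order with a least and no greatest element is isomorphic to ℕ.
  let _ : LocallyFiniteOrder (forest c) :=
    LocallyFiniteOrder.ofFiniteIcc fun a b => (hIic b).subset Set.Icc_subset_Iic_self
  let _ : OrderBot (forest c) := { bot := forestRoot c, bot_le := forestRoot_le }
  let _ := LinearLocallyFiniteOrder.succOrder (forest c)
  let _ := LinearLocallyFiniteOrder.predOrder (forest c)
  have : NoMaxOrder (forest c) := ⟨fun v =>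
    ⟨⟨toLex ((ofLex v.1).1 + 1, []), nil_mem_planeTree _⟩, forest_lt_of_fst_lt (Nat.lt_succ_self _)⟩⟩
  exact ⟨orderIsoNatOfLinearSuccPredArch.symm⟩

/-- If the first `h` trees and generations have at most `n` vertices in total then one of the
vertices `u 0, …, u n` has height at least `h`. -/
lemma exists_le_forestHeight (u : ℕ ≃o forest c) {n h : ℕ}
    (hn : ∑ k ∈ Finset.range h, branchSum 1 0 h (c k) ≤ n) :
    ∃ i ≤ n, h ≤ forestHeight (u i : ℕ ×ₗ List ℕ) := by
  by_contra hcon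
  push Not at hcon
  have hcard := Finset.card_le_card_of_injOn (s := Finset.range (n + 1))
    (t := ((Finset.range h).sigma fun k => truncTree h (c k) : Finset (Σ _ : ℕ, List ℕ)))
    (fun i => ⟨(ofLex (u i).1).1, (ofLex (u i).1).2⟩) (by
      intro i hi
      have h1 := hcon i (by simpa [Nat.lt_succ_iff] using hi)
      unfold forestHeight at h1
      simp only [Finset.mem_coe, Finset.mem_sigma, Finset.mem_range, mem_truncTree]
      exact ⟨by omega, (u i).2, by omega⟩)
    (fun i _ j _ hij => u.injective (forest_ext hij))
  rw [Finset.card_sigma, Finset.card_range] at hcard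
  simp only [card_truncTree] at hcard
  omega

/-- If the first `m` trees have more than `n` vertices in total then they contain all the vertices
`u 0, …, u n`. -/
lemma fst_lt_of_lt_sum (u : ℕ ≃o forest c) {n m h : ℕ}
    (hn : n < ∑ k ∈ Finset.range m, branchSum 1 0 h (c k)) {i : ℕ} (hi : i ≤ n) :
    (ofLex (u i).1).1 < m := by
  by_contra hcon
  push Not at hcon
  have hmem (p : Σ _ : ℕ, List ℕ)
      (hp : p ∈ (Finset.range m).sigma fun k => truncTree h (c k)) :
      p.1 < m ∧ p.2 ∈ planeTree (c p.1) := by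
    simp only [Finset.mem_sigma, Finset.mem_range, mem_truncTree] at hp
    exact ⟨hp.1, hp.2.1⟩
  have hcard := Finset.card_le_card_of_injOn
    -- If `u i` lay beyond the first m trees, all their vertices would have index below i ≤ n, too
    -- few indices for more than n vertices.
    (s := ((Finset.range m).sigma fun k => truncTree h (c k) : Finset (Σ _ : ℕ, List ℕ)).attach)
    (t := Finset.range i) (fun p => u.symm ⟨toLex (p.1.1, p.1.2), (hmem p.1 p.2).2⟩) (by
      intro p _
      rw [Finset.mem_coe, Finset.mem_range, ← u.lt_iff_lt, u.apply_symm_apply]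
      exact forest_lt_of_fst_lt ((hmem p.1 p.2).1.trans_le hcon)) (by
      intro p _ q _ hpq
      have h1 := congrArg (fun v : forest c => ofLex v.1) (u.symm.injective hpq)
      simp only [ofLex_toLex, Prod.mk.injEq] at h1
      exact Subtype.ext (Sigma.ext h1.1 (heq_of_eq h1.2)))
  rw [Finset.card_attach, Finset.card_sigma, Finset.card_range] at hcard
  simp only [card_truncTree] at hcard
  omega

lemma forestHeight_eq_zero_iff {v : forest c} :
    forestHeight (v : ℕ ×ₗ List ℕ) = 0 ↔ v = forestRoot c := by
  constructor
  · intro h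
    unfold forestHeight at h
    have h1 : (ofLex v.1).1 = 0 := by omega
    have h2 : (ofLex v.1).2 = [] := List.eq_nil_of_length_eq_zero (by omega)
    exact forest_ext (Sigma.ext h1 (heq_of_eq h2))
  · rintro rfl
    rfl

lemma orderIso_zero (u : ℕ ≃o forest c) : u 0 = forestRoot c := by
  refine le_antisymm ?_ (forestRoot_le _)
  rw [← u.apply_symm_apply (forestRoot c), u.le_iff_le]
  exact Nat.zero_le _

/-- Above height `1` every vertex is preceded by a vertex other than the root. -/
lemma exists_lt_of_two_le_forestHeight {v : forest c}
    (h : 2 ≤ forestHeight (v : ℕ ×ₗ List ℕ)) : ∃ v', forestRoot c < v' ∧ v' < v := by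
  obtain ⟨⟨k, w⟩, hv⟩ := v
  change 2 ≤ k + w.length at h
  change w ∈ planeTree (c k) at hv
  rcases Nat.lt_trichotomy k 1 with hk | rfl | hk
  · obtain rfl : k = 0 := by omega
    match w, h, hv with
    | a :: b :: w, _, hv =>
      refine ⟨⟨toLex (0, [a]), mem_planeTree_of_append (v := b :: w) hv⟩, ?_, ?_⟩
      · change toLex (0, []) < toLex (0, [a])
        rw [Prod.Lex.toLex_lt_toLex]
        exact Or.inr ⟨rfl, List.Lex.nil⟩
      · change toLex (0, [a]) < toLex (0, a :: b :: w)
        rw [Prod.Lex.toLex_lt_toLex]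
        exact Or.inr ⟨rfl, List.Lex.cons List.Lex.nil⟩
    | [a], h, _ => simp at h
    | [], h, _ => simp at h
  · refine ⟨⟨toLex (1, []), nil_mem_planeTree _⟩, forest_lt_of_fst_lt Nat.zero_lt_one, ?_⟩
    match w, h with
    | b :: w, _ =>
      change toLex (1, []) < toLex (1, b :: w)
      rw [Prod.Lex.toLex_lt_toLex]
      exact Or.inr ⟨rfl, List.Lex.nil⟩
    | [], h => simp at h
  · exact ⟨⟨toLex (1, []), nil_mem_planeTree _⟩, forest_lt_of_fst_lt Nat.zero_lt_one,
      forest_lt_of_fst_lt hk⟩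

/-- Needed for the exact formula at n = 1, where every power of n equals 1. -/
lemma forestHeight_orderIso_one (u : ℕ ≃o forest c) :
    forestHeight (u 1 : ℕ ×ₗ List ℕ) = 1 := by
  have h0 : forestHeight (u 1 : ℕ ×ₗ List ℕ) ≠ 0 := by
    rw [Ne, forestHeight_eq_zero_iff, ← orderIso_zero u, u.injective.eq_iff]
    exact one_ne_zero
  by_contra h1
  obtain ⟨v, hv0, hv1⟩ := exists_lt_of_two_le_forestHeight (v := u 1) (by omega)
  rw [← orderIso_zero u, ← u.apply_symm_apply v, u.lt_iff_lt] at hv0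
  rw [← u.apply_symm_apply v, u.lt_iff_lt] at hv1
  omega

end order

/-! ### From the times 4^j to all times. -/

/-- A monotone sequence that grows like `2 ^ j` at the times `4 ^ j`, up to arbitrarily small
exponential factors, has growth exponent `1 / 2`. -/
lemma tendsto_log_div_log_sub_half {M : ℕ → ℕ} (hM : Monotone M)
    (h : ∀ i : ℕ, ∀ᶠ j in atTop, (2 / (1 + 1 / ((i : ℝ) + 1))) ^ j ≤ (M (4 ^ j) : ℝ) ∧
      (M (4 ^ j) : ℝ) ≤ 4 * (2 * (1 + 1 / ((i : ℝ) + 1)) ^ 2) ^ j) :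
    Tendsto (fun n : ℕ => Real.log (M n) / Real.log n - 1 / 2) atTop (𝓝 0) := by
  rw [Metric.tendsto_atTop]
  intro δ hδ
  have hL : 0 < Real.log 2 := Real.log_pos (by norm_num)
  set L := Real.log 2 with hLdef
  have hL4 : Real.log 4 = 2 * L := by
    rw [show (4 : ℝ) = 2 ^ 2 by norm_num, Real.log_pow]; norm_num [hLdef]
  obtain ⟨i, hi⟩ := exists_nat_gt (1 / (L * (δ / 4)))
  obtain ⟨J, hJ⟩ := eventually_atTop.1 (h i)
  have hi0 : (0 : ℝ) < (i : ℝ) + 1 := by positivity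
  set θ : ℝ := 1 + 1 / ((i : ℝ) + 1) with hθ
  have hθ1 : 1 < θ := by rw [hθ]; linarith [one_div_pos.2 hi0]
  have hθ0 : 0 < θ := by linarith
  set l := Real.log θ with hl
  have hl0 : 0 < l := Real.log_pos hθ1
  have hlδ : l ≤ L * (δ / 4) := by
    have h1 : l ≤ θ - 1 := Real.log_le_sub_one_of_pos hθ0
    have h2 : 1 / ((i : ℝ) + 1) ≤ L * (δ / 4) := by
      rw [div_le_iff₀ hi0]
      rw [div_lt_iff₀ (by positivity)] at hi
      nlinarith [mul_pos hL hδ]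
    rw [hθ] at h1
    linarith
  have hlog : Tendsto (fun n : ℕ => Real.log n) atTop atTop :=
    Real.tendsto_log_atTop.comp tendsto_natCast_atTop_atTop
  -- The upper bound 2L + (j+1)(L + 2l) has constant part 3L + 2l, which must be less than (δ/2) log
  -- n.
  obtain ⟨N, hN⟩ := eventually_atTop.1 (hlog.eventually_gt_atTop ((3 * L + 2 * l) / (δ / 2)))
  refine ⟨max N (4 ^ J), fun n hn => ?_⟩
  have hnN : N ≤ n := (le_max_left _ _).trans hn
  have hnJ : 4 ^ J ≤ n := (le_max_right _ _).trans hn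
  have hn0 : n ≠ 0 := (lt_of_lt_of_le (by positivity) hnJ).ne'
  have hnr : (0 : ℝ) < n := by exact_mod_cast Nat.pos_of_ne_zero hn0
  set j := Nat.log 4 n with hj
  have hj1 : 4 ^ j ≤ n := Nat.pow_log_le_self 4 hn0
  have hj2 : n < 4 ^ (j + 1) := Nat.lt_pow_succ_log_self (by norm_num) n
  have hJj : J ≤ j := (Nat.le_log_iff_pow_le (by norm_num) hn0).2 hnJ
  have hlogn := hN n hnN
  rw [div_lt_iff₀ (by positivity)] at hlogn
  have hA : j * (2 * L) ≤ Real.log n := by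
    have h1 : Real.log ((4 : ℝ) ^ j) ≤ Real.log n :=
      Real.log_le_log (by positivity) (by exact_mod_cast hj1)
    rwa [Real.log_pow, hL4] at h1
  have hB : Real.log n ≤ (j + 1) * (2 * L) := by
    have h1 : Real.log n ≤ Real.log ((4 : ℝ) ^ (j + 1)) :=
      Real.log_le_log hnr (by exact_mod_cast hj2.le)
    rw [Real.log_pow, hL4] at h1
    exact_mod_cast h1
  have hlow : j * (L - l) ≤ Real.log (M n) := by
    have h1 : (2 / θ) ^ j ≤ (M n : ℝ) :=
      (hJ j hJj).1.trans (by exact_mod_cast hM hj1)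
    have h2 := Real.log_le_log (by positivity) h1
    rwa [Real.log_pow, Real.log_div (by norm_num) hθ0.ne'] at h2
  have hMpos : (0 : ℝ) < M n :=
    lt_of_lt_of_le (by positivity : (0 : ℝ) < (2 / θ) ^ j)
      ((hJ j hJj).1.trans (by exact_mod_cast hM hj1))
  have hupp : Real.log (M n) ≤ 2 * L + (j + 1) * (L + 2 * l) := by
    have h1 : (M n : ℝ) ≤ 4 * (2 * θ ^ 2) ^ (j + 1) :=
      le_trans (by exact_mod_cast hM hj2.le) (hJ (j + 1) (by omega)).2
    have h2 := Real.log_le_log hMpos h1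
    rw [Real.log_mul (by norm_num) (by positivity), Real.log_pow,
      Real.log_mul (by norm_num) (by positivity), Real.log_pow, hL4] at h2
    exact_mod_cast h2
  have hjl : (j : ℝ) * l ≤ Real.log n * (δ / 8) := by
    calc (j : ℝ) * l ≤ j * (L * (δ / 4)) := by gcongr
      _ = (j * (2 * L)) * (δ / 8) := by ring
      _ ≤ Real.log n * (δ / 8) := by gcongr
  have hlognpos : 0 < Real.log n := by
    by_contra hcon
    nlinarith
  rw [Real.dist_eq, sub_zero, abs_lt]
  constructor
  · rw [lt_sub_iff_add_lt, lt_div_iff₀ hlognpos]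
    nlinarith [mul_pos hlognpos hδ]
  · rw [sub_lt_iff_lt_add, div_lt_iff₀ hlognpos]
    nlinarith [mul_pos hlognpos hδ]

/-! ### Growth of the maximal height. -/

section growth

variable {c : ℕ → List ℕ → ℕ}

/-- The largest height among the vertices `u 0, …, u n`. -/
def maxHeight (u : ℕ ≃o forest c) (n : ℕ) : ℕ :=
  (Finset.range (n + 1)).sup fun i => forestHeight (u i : ℕ ×ₗ List ℕ)

lemma monotone_maxHeight (u : ℕ ≃o forest c) : Monotone (maxHeight u) := fun _ _ h =>
  Finset.sup_mono (Finset.range_subset_range.2 (Nat.succ_le_succ h))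

lemma maxHeight_zero (u : ℕ ≃o forest c) : maxHeight u 0 = 0 := by
  simp [maxHeight, forestHeight_eq_zero_iff, orderIso_zero]

lemma maxHeight_one (u : ℕ ≃o forest c) : maxHeight u 1 = 1 := by
  simp [maxHeight, Finset.range_add_one, forestHeight_orderIso_one,
    forestHeight_eq_zero_iff.2 (orderIso_zero u)]

lemma GrowthAt.bounds {θ : ℝ} (h1 : 1 < θ) {j : ℕ} (hc : GrowthAt c θ j) (u : ℕ ≃o forest c) :
    (2 / θ) ^ j ≤ (maxHeight u (4 ^ j) : ℝ) ∧
      (maxHeight u (4 ^ j) : ℝ) ≤ 4 * (2 * θ ^ 2) ^ j := by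
  obtain ⟨hlow, ⟨h, hsize⟩, hext⟩ := hc
  constructor
  · obtain ⟨i, hi, hh⟩ := exists_le_forestHeight u hlow
    refine (Nat.le_ceil _).trans ?_
    have h2 : forestHeight (u i : ℕ ×ₗ List ℕ) ≤ maxHeight u (4 ^ j) :=
      Finset.le_sup (f := fun i => forestHeight (u i : ℕ ×ₗ List ℕ))
        (Finset.mem_range.2 (Nat.lt_succ_of_le hi))
    exact_mod_cast hh.trans h2
  · have hle : maxHeight u (4 ^ j) ≤ ⌈(2 * θ) ^ j⌉₊ + ⌈(2 * θ ^ 2) ^ j⌉₊ := by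
      refine Finset.sup_le fun i hi => ?_
      have hk := fst_lt_of_lt_sum u hsize (Nat.lt_succ_iff.1 (Finset.mem_range.1 hi))
      have hw := length_lt_of_branchSum_eq_zero (hext _ hk) (u i).2
      unfold forestHeight
      omega
    have hm := ceil_le_two_mul_of_one_le (x := (2 * θ) ^ j) (one_le_pow₀ (by linarith))
    have hH := ceil_le_two_mul_of_one_le (x := (2 * θ ^ 2) ^ j) (one_le_pow₀ (by nlinarith))
    have hmH : (2 * θ) ^ j ≤ (2 * θ ^ 2) ^ j :=
      pow_le_pow_left₀ (by linarith) (by nlinarith) j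
    have : (maxHeight u (4 ^ j) : ℝ) ≤ ⌈(2 * θ) ^ j⌉₊ + ⌈(2 * θ ^ 2) ^ j⌉₊ := by
      exact_mod_cast hle
    linarith

/-- The last clause of `GrowthAt` covers a range of trees that eventually includes k, so finiteness
of the trees comes for free. -/
lemma exists_branchSum_eq_zero {θ : ℝ} (h1 : 1 < θ) (hc : ∀ᶠ j in atTop, GrowthAt c θ j) (k : ℕ) :
    ∃ h, branchSum 0 1 h (c k) = 0 := by
  have h2 : ∀ᶠ j : ℕ in atTop, (k : ℝ) < (2 * θ) ^ j :=
    (tendsto_pow_atTop_atTop_of_one_lt (by linarith)).eventually_gt_atTop _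
  obtain ⟨j, hj, hk⟩ := (hc.and h2).exists
  exact ⟨_, hj.2.2 k (Nat.lt_ceil.2 hk)⟩

lemma exists_exponent (hc : ∀ i : ℕ, ∀ᶠ j in atTop, GrowthAt c (1 + 1 / ((i : ℝ) + 1)) j)
    (u : ℕ ≃o forest c) : ∃ ε : ℕ → ℝ, Tendsto ε atTop (𝓝 0) ∧
      ∀ n : ℕ, (maxHeight u n : ℝ) = (n : ℝ) ^ (1 / 2 + ε n) := by
  have hlim := tendsto_log_div_log_sub_half (monotone_maxHeight u) fun i =>
    (hc i).mono fun j hj => hj.bounds (by linarith [Nat.one_div_pos_of_nat (α := ℝ) (n := i)]) u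
  -- At n = 0 the exponent must be nonzero, since 0^0 = 1 but the maximal height is 0; the quotient
  -- formula would give exponent 0 there.
  refine ⟨fun n => if n = 0 then 0 else Real.log (maxHeight u n) / Real.log n - 1 / 2,
    hlim.congr' ?_, fun n => ?_⟩
  · filter_upwards [eventually_ne_atTop 0] with n hn
    rw [if_neg hn]
  rcases n with _ | _ | n
  · simp [maxHeight_zero]
  · simp [maxHeight_one]
  · have hn : (1 : ℝ) < ((n + 1 + 1 : ℕ) : ℝ) := by
      exact_mod_cast (by omega : 1 < n + 1 + 1)
    have hpos : 0 < maxHeight u (n + 1 + 1) :=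
      lt_of_lt_of_le (by rw [maxHeight_one]; exact one_pos)
        (monotone_maxHeight u (by omega : 1 ≤ n + 1 + 1))
    beta_reduce
    rw [if_neg (by omega : n + 1 + 1 ≠ 0), add_sub_cancel, ← Real.logb,
      Real.rpow_logb (by linarith) hn.ne' (by exact_mod_cast hpos)]

end growth

theorem lemma2p4 {Ω : Type*} [MeasurableSpace Ω] (P : Measure Ω) [IsProbabilityMeasure P]
    (μ : Measure ℕ) [IsProbabilityMeasure μ] (hμ_ne : μ ≠ Measure.dirac 1)
    (hμ_var : MemLp (fun k : ℕ => (k : ℝ)) 2 μ) (hμ_mean : ∫ k : ℕ, (k : ℝ) ∂μ = 1)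
    (ξ : ℕ → List ℕ → Ω → ℕ) (hξ_law : ∀ k w, HasLaw (ξ k w) μ P)
    (hξ_indep : iIndepFun (fun v : ℕ × List ℕ => ξ v.1 v.2) P) :
    ∀ᵐ ω ∂P,
      Nonempty (ℕ ≃o forest fun k w => ξ k w ω) ∧
      ∀ u : ℕ ≃o forest fun k w => ξ k w ω,
        ∃ ε : ℕ → ℝ, Tendsto ε atTop (𝓝 0) ∧ ∀ n : ℕ,
          (((Finset.range (n + 1)).sup fun i =>
            (forestGraph fun k w => ξ k w ω).dist (forestRoot fun k w => ξ k w ω) (u i) : ℕ) : ℝ)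
            = (n : ℝ) ^ (1 / 2 + ε n) := by
  have hθ (i : ℕ) : 1 < 1 + 1 / ((i : ℝ) + 1) ∧ 1 + 1 / ((i : ℝ) + 1) ≤ 2 := by
    have h1 := Nat.one_div_pos_of_nat (α := ℝ) (n := i)
    have h2 : 1 / ((i : ℝ) + 1) ≤ 1 := by
      rw [div_le_one (by positivity)]
      linarith [i.cast_nonneg (α := ℝ)]
    constructor <;> linarith
  have hlaw := hasLaw_forestLaw μ hξ_law hξ_indep
  have hgrowth : ∀ᵐ c ∂(forestLaw μ), ∀ i : ℕ, ∀ᶠ j in atTop,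
      GrowthAt c (1 + 1 / ((i : ℝ) + 1)) j :=
    ae_all_iff.2 fun i => ae_eventually_growthAt μ hμ_ne hμ_var hμ_mean (hθ i).1 (hθ i).2
  rw [← hlaw.map_eq] at hgrowth
  filter_upwards [ae_of_ae_map hlaw.aemeasurable hgrowth] with ω hω
  refine ⟨nonempty_orderIso_forest (exists_branchSum_eq_zero (hθ 0).1 (hω 0)), fun u => ?_⟩
  simp only [dist_forestRoot]
  exact exists_exponent hω u
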